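/- Let $F \subseteq E$ be a finite Galois extension with Galois group $\mathrm{Gal}(E,F)$, and let $\mathfrak g$ and $\mathfrak h$ be Lie algebras over $E$ with $\mathfrak g$ finite-dimensional. Let $\mathfrak g_F$ and $\mathfrak h_F$ denote the Lie algebras over $F$ obtained from them by restricting the scalars to $F$, and suppose that $\mathfrak g_F \cong \mathfrak h_F$ as Lie algebras over $F$. Let $\mathfrak g = \bigoplus_{i=1}^k \mathfrak g_i$ be a decomposition of $\mathfrak g$ as a direct sum of indecomposable ideals, where a Lie algebra is called indecomposable if it is not the direct sum of two proper ideals. Then there exist $\sigma_1, \dots, \sigma_k \in \mathrm{Gal}(E,F)$ such that $$\mathfrak h \cong \bigoplus_{i=1}^k \mathfrak g_i^{\sigma_i}$$ as Lie algebras over $E$. Here, for a Lie algebra $\mathfrak l$ over $E$ and an automorphism $\sigma$ of $E$, the $\sigma$-conjugate $\mathfrak l^{\sigma}$ is the Lie algebra over $E$, unique up to isomorphism, for which there is a bijective map $\varphi : \mathfrak l \to \mathfrak l^{\sigma}$ that preserves addition and Lie brackets and satisfies $\varphi(\lambda x) = \sigma(\lambda)\varphi(x)$ for all $\lambda \in E$,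 $x \in \mathfrak l$. -/

import Mathlib

open scoped DirectSum

namespace UnderlyingLie

section Indecomposable

variable (E : Type*) [CommRing E] (L : Type*) [LieRing L] [LieAlgebra E L]

/-- A Lie algebra is decomposable if it is the direct sum of two proper ideals. -/
def IsDecomposable : Prop :=
  ∃ I J : LieIdeal E L, I ≠ ⊤ ∧ J ≠ ⊤ ∧ IsCompl I J

/-- A Lie algebra is indecomposable if it is not the direct sum of two proper ideals.
The zero Lie algebra has no proper ideals, so it counts as indecomposable here. -/
def IsIndecomposable : Prop := ¬ IsDecomposable E L

variable {L}

/-- A finite family of ideals is a decomposition into indecomposable ideals if the Lie algebra is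
their internal direct sum and each ideal, as a Lie algebra in its own right, is indecomposable. -/
structure IsIndecomposableDecomposition {k : ℕ} (I : Fin k → LieIdeal E L) : Prop where
  isInternal : DirectSum.IsInternal I
  indecomposable : ∀ i, IsIndecomposable E (I i)

end Indecomposable

section Conjugate

variable {E : Type*} [Field E]

/-- A `σ`-isomorphism of Lie algebras over `E`: a bijective `σ`-linear map preserving the
bracket. -/
structure SigmaIso (σ : E ≃+* E) (L L' : Type*) [LieRing L] [LieAlgebra E L]
    [LieRing L'] [LieAlgebra E L'] where
  toFun : L → L'
  bijective : Function.Bijective toFun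
  map_add : ∀ x y, toFun (x + y) = toFun x + toFun y
  map_smul : ∀ (c : E) (x : L), toFun (c • x) = σ c • toFun x
  map_lie : ∀ x y, toFun ⁅x, y⁆ = ⁅toFun x, toFun y⁆

/-- The `σ`-conjugate of a Lie algebra `L` over `E`: the same Lie ring, on which `c : E` acts as
`σ⁻¹ c` acts on `L`. The identity map is then a `σ`-isomorphism from `L`, see
`Conjugate.sigmaIso`; this determines the conjugate up to isomorphism, see
`Conjugate.nonempty_lieEquiv`. -/
def Conjugate (_σ : E ≃+* E) (L : Type*) : Type _ := L

namespace Conjugate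

variable (σ : E ≃+* E) (L : Type*) [LieRing L]

instance : LieRing (Conjugate σ L) := inferInstanceAs (LieRing L)

/-- The identity map from a Lie algebra to its conjugate. -/
def of : L ≃+ Conjugate σ L := AddEquiv.refl L

theorem lie_def (x y : Conjugate σ L) :
    ⁅x, y⁆ = of σ L ⁅(of σ L).symm x, (of σ L).symm y⁆ := rfl

variable [LieAlgebra E L]

instance : Module E (Conjugate σ L) :=
  { (Module.compHom L (σ.symm : E →+* E) : Module E L) with
    smul := fun c x => of σ L (σ.symm c • (of σ L).symm x) }

theorem smul_def (c : E) (x : Conjugate σ L) :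
    c • x = of σ L (σ.symm c • (of σ L).symm x) := rfl

instance : LieAlgebra E (Conjugate σ L) where
  lie_smul c x y := by
    simp only [smul_def, lie_def, AddEquiv.symm_apply_apply, lie_smul]

/-- The identity map is a `σ`-isomorphism from `L` to its `σ`-conjugate. -/
def sigmaIso : SigmaIso σ L (Conjugate σ L) where
  toFun := of σ L
  bijective := (of σ L).bijective
  map_add := (of σ L).map_add
  map_smul c x := by simp [smul_def]
  map_lie _ _ := rfl

/-- Every Lie algebra which admits a `σ`-isomorphism from `L` is isomorphic to the
`σ`-conjugate. -/
theorem nonempty_lieEquiv {L' : Type*} [LieRing L'] [LieAlgebra E L'] (φ : SigmaIso σ L L') :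
    Nonempty (Conjugate σ L ≃ₗ⁅E⁆ L') := by
  let ψ : Conjugate σ L →ₗ⁅E⁆ L' :=
    { toFun := fun x => φ.toFun ((of σ L).symm x)
      map_add' := fun x y => by simp [φ.map_add]
      map_smul' := fun c x => by simp [smul_def, φ.map_smul]
      map_lie' := fun {x y} => by simp [lie_def, φ.map_lie] }
  exact ⟨LieEquiv.ofBijective ψ (φ.bijective.comp (of σ L).symm.bijective)⟩

end Conjugate

end Conjugate

end UnderlyingLie

/-! Extending scalars turns the hypothesis into a statement over `E`: since `E/F` is Galois, `E ⊗[F]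
g_F` is the product of all conjugates `g^σ` (`tensorHom_bijective`), so `∏ g^σ ≅ ∏ h^σ` over `E`.
What remains is a Krull–Schmidt argument.

By Fitting's lemma the centroid of a finite-dimensional indecomposable Lie algebra is local. This
gives exchange (`IsIndecomposable.exists_equiv_prod`) and cancellation of finite-dimensional factors
(`nonempty_equiv_of_prod`); complements may be non-unique because of the centre, so both hold only
up to isomorphism.

The summand `g₁` is a direct factor of `∏ g^σ`, hence of some `h^ρ`. Conjugating by `τ = ρ⁻¹`, `h ≅
g₁^τ × h'`. The products attached to `g₁` and to `g₁^τ` differ only in their indexing, so they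
cancel, and induction on the number of summands applies to the remaining summands and `h'`. -/

namespace UnderlyingLie

universe u

/-! ### Fitting's lemma and locality of the centroid -/

section Fitting

variable {E M : Type*} [Field E] [LieRing M] [LieAlgebra E M] [FiniteDimensional E M]

/-- Fitting's lemma for an element of the centroid of an indecomposable Lie algebra. -/
theorem IsIndecomposable.isNilpotent_or_bijective (hM : IsIndecomposable E M)
    (u : Module.End E M) (hu : ∀ x y : M, u ⁅x, y⁆ = ⁅x, u y⁆) :
    IsNilpotent u ∨ Function.Bijective u := by
  -- The condition `0 < n` is what lets surjectivity of `u ^ n` pass to `u`.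
  obtain ⟨n, hn, hn0⟩ :=
    (u.eventually_isCompl_ker_pow_range_pow.and (Filter.eventually_gt_atTop 0)).exists
  have hpow : ∀ (m : ℕ) (x y : M), (u ^ m) ⁅x, y⁆ = ⁅x, (u ^ m) y⁆ := by
    intro m x y
    induction m with
    | zero => simp
    | succ m ih => rw [pow_succ', Module.End.mul_apply, ih, hu, Module.End.mul_apply]
  let I : LieIdeal E M :=
    { LinearMap.ker (u ^ n) with
      lie_mem := fun {x m} hm => by
        have hm' : (u ^ n) m = 0 := hm
        change (u ^ n) ⁅x, m⁆ = 0
        rw [hpow, hm', lie_zero] }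
  let J : LieIdeal E M :=
    { LinearMap.range (u ^ n) with
      lie_mem := fun {x m} hm => by
        obtain ⟨y, rfl⟩ := hm
        exact ⟨⁅x, y⁆, hpow n x y⟩ }
  have hIJ : IsCompl I J := LieSubmodule.isCompl_toSubmodule.mp hn
  by_cases hI : I = ⊤
  · refine .inl ⟨n, LinearMap.ext fun x => ?_⟩
    have : x ∈ I := hI ▸ LieSubmodule.mem_top x
    exact this
  by_cases hJ : J = ⊤
  · right
    have hs : Function.Surjective u := by
      intro x
      have : x ∈ J := hJ ▸ LieSubmodule.mem_top x
      obtain ⟨y, rfl⟩ := this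
      obtain ⟨m, rfl⟩ := Nat.exists_eq_succ_of_ne_zero hn0.ne'
      exact ⟨(u ^ m) y, by rw [Nat.succ_eq_add_one, pow_succ', Module.End.mul_apply]⟩
    exact ⟨LinearMap.injective_iff_surjective.mpr hs, hs⟩
  exact (hM ⟨I, J, hI, hJ, hIJ⟩).elim

/-- The centroid of an indecomposable Lie algebra is local. -/
theorem IsIndecomposable.bijective_or_of_add (hM : IsIndecomposable E M)
    (u v : Module.End E M) (hu : ∀ x y : M, u ⁅x, y⁆ = ⁅x, u y⁆)
    (hv : ∀ x y : M, v ⁅x, y⁆ = ⁅x, v y⁆) (h : Function.Bijective ⇑(u + v)) :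
    Function.Bijective u ∨ Function.Bijective v := by
  simp only [← Module.End.isUnit_iff] at h ⊢
  obtain ⟨s, hs⟩ := h
  set w : Module.End E M := ↑s⁻¹ with hw
  have hsw : ∀ x, (u + v) (w x) = x := fun x => by
    rw [← hs, ← Module.End.mul_apply, hw, s.mul_inv, Module.End.one_apply]
  have hws : ∀ x, w ((u + v) x) = x := fun x => by
    rw [← hs, ← Module.End.mul_apply, hw, s.inv_mul, Module.End.one_apply]
  -- The inverse of a centroid element is again in the centroid, so Fitting's lemma applies to `w *
  -- u`; if that is nilpotent, `1 - w * u = w * v` is a unit.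
  have hwl : ∀ x y : M, w ⁅x, y⁆ = ⁅x, w y⁆ := fun x y => by
    have : (u + v) ⁅x, w y⁆ = ⁅x, y⁆ := by
      conv_rhs => rw [← hsw y]
      simp only [LinearMap.add_apply, hu, hv, lie_add]
    rw [← this, hws]
  have hwu : IsUnit w := s⁻¹.isUnit
  rcases hM.isNilpotent_or_bijective (w * u)
    (fun x y => by simp only [Module.End.mul_apply, hu, hwl]) with hn | hb
  · right
    have h1 : IsUnit (1 - w * u) := hn.isUnit_one_sub
    have h2 : 1 - w * u = w * v := by
      rw [sub_eq_iff_eq_add', ← mul_add, ← hs, hw, s.inv_mul]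
    rw [h2] at h1
    exact (s⁻¹.isUnit_units_mul v).mp h1
  · left
    rw [← Module.End.isUnit_iff] at hb
    exact (s⁻¹.isUnit_units_mul u).mp hb

theorem IsIndecomposable.exists_bijective_of_sum (hM : IsIndecomposable E M) {ι : Type*}
    {s : Finset ι} (hs : s.Nonempty) (u : ι → Module.End E M)
    (hu : ∀ i, ∀ x y : M, u i ⁅x, y⁆ = ⁅x, u i y⁆)
    (h : Function.Bijective ⇑(∑ i ∈ s, u i)) : ∃ i ∈ s, Function.Bijective (u i) := by
  induction hs using Finset.Nonempty.cons_induction with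
  | singleton a => exact ⟨a, by simp, by simpa using h⟩
  | cons a s ha hs ih =>
    rw [Finset.sum_cons] at h
    rcases hM.bijective_or_of_add _ _ (hu a)
      (fun x y => by simp only [LinearMap.sum_apply, hu, lie_sum]) h with h | h
    · exact ⟨a, by simp, h⟩
    · obtain ⟨i, hi, hb⟩ := ih h
      exact ⟨i, by simp [hi], hb⟩

end Fitting

/-! ### Direct factors and the centroid elements they induce -/

section ReciprocalPair

variable (R : Type*) [CommRing R] (M N P : Type*)
  [LieRing M] [LieAlgebra R M] [LieRing N] [LieAlgebra R N] [LieRing P] [LieAlgebra R P]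

/-- A pair of opposite morphisms of Lie algebras satisfying the projection formulas, such as the
inclusion of a direct factor and the projection onto it. -/
structure ReciprocalPair where
  hom : M →ₗ⁅R⁆ N
  back : N →ₗ⁅R⁆ M
  hom_lie : ∀ x y, hom ⁅x, back y⁆ = ⁅hom x, y⁆
  back_lie : ∀ x y, back ⁅hom x, y⁆ = ⁅x, back y⁆

namespace ReciprocalPair

variable {R M N P}

/-- Composition of reciprocal pairs. -/
def comp (q : ReciprocalPair R N P) (p : ReciprocalPair R M N) : ReciprocalPair R M P where
  hom := q.hom.comp p.hom
  back := p.back.comp q.back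
  hom_lie x y := by simp only [LieHom.comp_apply, p.hom_lie, q.hom_lie]
  back_lie x y := by simp only [LieHom.comp_apply, p.back_lie, q.back_lie]

/-- The reciprocal pair with both morphisms exchanged. -/
def symm (p : ReciprocalPair R M N) : ReciprocalPair R N M where
  hom := p.back
  back := p.hom
  hom_lie x y := by rw [← lie_skew, map_neg, p.back_lie, lie_skew]
  back_lie x y := by rw [← lie_skew, map_neg, p.hom_lie, lie_skew]

/-- An isomorphism and its inverse. -/
def ofEquiv (e : M ≃ₗ⁅R⁆ N) : ReciprocalPair R M N where
  hom := e
  back := e.symm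
  hom_lie x y := by
    rw [LieHom.map_lie]; congr 1; exact e.apply_symm_apply y
  back_lie x y := by
    rw [LieHom.map_lie]; congr 1; exact e.symm_apply_apply x

variable (R M N) in
/-- The inclusion of, and the projection onto, the first factor of a product. -/
def inl : ReciprocalPair R M (M × N) where
  hom := LieHom.inl R M N
  back := LieHom.fst R M N
  hom_lie x y := by simp
  back_lie x y := by simp

variable (R M N) in
/-- The inclusion of, and the projection onto, the second factor of a product. -/
def inr : ReciprocalPair R N (M × N) where
  hom := LieHom.inr R M N
  back := LieHom.snd R M N
  hom_lie x y := by simp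
  back_lie x y := by simp

/-- Round trips lie in the centroid, which makes the locality results available for them. -/
theorem back_hom_lie (p : ReciprocalPair R M N) (x y : M) :
    p.back (p.hom ⁅x, y⁆) = ⁅x, p.back (p.hom y)⁆ := by
  rw [LieHom.map_lie, p.back_lie]

/-- If the round trip through `N` is bijective, then `M` is a direct factor of `N`. -/
theorem exists_equiv_prod_ker (p : ReciprocalPair R M N)
    (h : Function.Bijective fun x => p.back (p.hom x)) :
    ∃ φ : (M × p.back.ker) ≃ₗ⁅R⁆ N, ∀ z, φ z = p.hom z.1 + (z.2 : N) := by
  -- The projection formula makes the image of `hom` commute with the kernel of `back`, so the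
  -- linear splitting respects brackets.
  have hker : ∀ (m : M) (b : p.back.ker), ⁅p.hom m, (b : N)⁆ = 0 := fun m b => by
    rw [← p.hom_lie, LieHom.mem_ker.mp b.2, lie_zero, map_zero]
  have hker' : ∀ (m : M) (b : p.back.ker), ⁅(b : N), p.hom m⁆ = 0 := fun m b => by
    rw [← lie_skew, hker, neg_zero]
  let f : (M × p.back.ker) →ₗ⁅R⁆ N :=
    { toFun := fun z => p.hom z.1 + (z.2 : N)
      map_add' := fun y z => by
        simp only [Prod.fst_add, Prod.snd_add, map_add, LieSubmodule.coe_add]; abel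
      map_smul' := fun c z => by
        simp only [Prod.smul_fst, Prod.smul_snd, map_smul, LieSubmodule.coe_smul, smul_add,
          RingHom.id_apply]
      map_lie' := fun {y z} => by
        simp only [LieAlgebra.Prod.bracket_apply, LieHom.map_lie, lie_add, add_lie, hker, hker',
          add_zero, zero_add]
        rfl }
  have hf : ∀ z, f z = p.hom z.1 + (z.2 : N) := fun _ => rfl
  refine ⟨LieEquiv.ofBijective f ⟨?_, fun n => ?_⟩, hf⟩
  · refine (injective_iff_map_eq_zero f).mpr fun z hz => ?_
    rw [hf] at hz
    have h1 : z.1 = 0 := by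
      refine h.1 ?_
      have := congrArg p.back hz
      simpa [LieHom.mem_ker.mp z.2.2] using this
    rw [h1, map_zero, zero_add] at hz
    exact Prod.ext h1 (Subtype.ext hz)
  · obtain ⟨m, hm⟩ := h.2 (p.back n)
    refine ⟨(m, ⟨n - p.hom m, LieHom.mem_ker.mpr ?_⟩), ?_⟩
    · rw [map_sub, ← hm, sub_self]
    · rw [hf]; exact add_sub_cancel _ _

end ReciprocalPair

end ReciprocalPair

/-! ### Binary products -/

section Prod

variable (R : Type*) [CommRing R] (L₁ L₂ L₃ : Type*) {M₁ M₂ : Type*}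
  [LieRing L₁] [LieAlgebra R L₁] [LieRing L₂] [LieAlgebra R L₂] [LieRing L₃] [LieAlgebra R L₃]
  [LieRing M₁] [LieAlgebra R M₁] [LieRing M₂] [LieAlgebra R M₂]

/-- Products of Lie algebras are associative. -/
def prodAssocLieEquiv : ((L₁ × L₂) × L₃) ≃ₗ⁅R⁆ L₁ × L₂ × L₃ where
  __ := LinearEquiv.prodAssoc R L₁ L₂ L₃
  map_lie' := rfl

variable {R L₁ L₂}

/-- The product of two isomorphisms of Lie algebras. -/
def prodCongrLieEquiv (e₁ : L₁ ≃ₗ⁅R⁆ M₁) (e₂ : L₂ ≃ₗ⁅R⁆ M₂) : (L₁ × L₂) ≃ₗ⁅R⁆ M₁ × M₂ where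
  __ := LinearEquiv.prodCongr e₁.toLinearEquiv e₂.toLinearEquiv
  map_lie' := by
    intro x y
    exact Prod.ext (e₁.map_lie x.1 y.1) (e₂.map_lie x.2 y.2)

/-- A Lie algebra is the product of two complementary ideals. -/
theorem nonempty_prod_equiv_of_isCompl {I J : LieIdeal R L₁} (h : IsCompl I J) :
    Nonempty ((I × J) ≃ₗ⁅R⁆ L₁) := by
  have h0 : ∀ {x y : L₁}, x ∈ I → y ∈ J → ⁅x, y⁆ = 0 := fun {x y} hx hy => by
    have h1 : ⁅x, y⁆ ∈ I ⊓ J := ⟨lie_mem_left R L₁ I x y hx, J.lie_mem hy⟩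
    rwa [h.inf_eq_bot, LieSubmodule.mem_bot] at h1
  have h0' : ∀ {x y : L₁}, x ∈ I → y ∈ J → ⁅y, x⁆ = 0 := fun {x y} hx hy => by
    rw [← lie_skew, h0 hx hy, neg_zero]
  have hlin := LieSubmodule.isCompl_toSubmodule.mpr h
  let e := Submodule.prodEquivOfIsCompl _ _ hlin
  exact ⟨{ e with
    map_lie' := fun {x y} => by
      have he : ∀ z : I × J, e z = (z.1 : L₁) + (z.2 : L₁) := fun z =>
        Submodule.coe_prodEquivOfIsCompl' _ _ hlin z
      change e _ = ⁅e x, e y⁆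
      rw [he, he, he]
      simp only [lie_add, add_lie, h0 x.1.2 y.2.2, h0' y.1.2 x.2.2, add_zero, zero_add]
      rfl }⟩

end Prod

/-! ### Cancellation of finite-dimensional factors -/

section Cancellation

/-- Two complements of isomorphic direct factors are isomorphic, provided that the second factor
projects isomorphically onto the first one. -/
theorem nonempty_equiv_of_bijective_fst_symm {R M N A B : Type*} [CommRing R]
    [LieRing M] [LieAlgebra R M] [LieRing N] [LieAlgebra R N]
    [LieRing A] [LieAlgebra R A] [LieRing B] [LieAlgebra R B]
    (e : (M × A) ≃ₗ⁅R⁆ N × B) (h : Function.Bijective fun n : N => (e.symm (n, 0)).1) :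
    Nonempty (A ≃ₗ⁅R⁆ B) := by
  let f : A →ₗ⁅R⁆ B := (LieHom.snd R N B).comp ((e : (M × A) →ₗ⁅R⁆ N × B).comp (LieHom.inr R M A))
  have hf : ∀ a, f a = (e (0, a)).2 := fun _ => rfl
  refine ⟨LieEquiv.ofBijective f ⟨?_, fun b => ?_⟩⟩
  · refine (injective_iff_map_eq_zero f).mpr fun a ha => ?_
    rw [hf] at ha
    have h1 : e (0, a) = ((e (0, a)).1, 0) := Prod.ext rfl ha
    have h2 : e.symm ((e (0, a)).1, 0) = (0, a) := by rw [← h1, e.symm_apply_apply]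
    have h3 : (e (0, a)).1 = 0 := by
      refine h.1 ?_
      simp only [h2]
      rw [Prod.mk_zero_zero, map_zero, Prod.fst_zero]
    rw [h3, Prod.mk_zero_zero, map_zero] at h2
    exact (congrArg Prod.snd h2).symm
  · obtain ⟨n, hn⟩ := h.2 (-(e.symm (0, b)).1)
    refine ⟨(e.symm (n, b)).2, ?_⟩
    have h1 : e.symm (n, b) = e.symm (n, 0) + e.symm (0, b) := by
      rw [← map_add, Prod.mk_add_mk, add_zero, zero_add]
    have h2 : (e.symm (n, b)).1 = 0 := by
      rw [h1, Prod.fst_add]; simp only at hn; rw [hn, neg_add_cancel]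
    have h3 : (0, (e.symm (n, b)).2) = e.symm (n, b) := Prod.ext h2.symm rfl
    rw [hf, h3, e.apply_symm_apply]

variable {E : Type*} [Field E]

/-- An indecomposable finite-dimensional Lie algebra can be cancelled from a product. -/
theorem IsIndecomposable.nonempty_equiv_of_prod {M A B : Type*}
    [LieRing M] [LieAlgebra E M] [FiniteDimensional E M] [LieRing A] [LieAlgebra E A]
    [LieRing B] [LieAlgebra E B] (hM : IsIndecomposable E M) (e : (M × A) ≃ₗ⁅E⁆ M × B) :
    Nonempty (A ≃ₗ⁅E⁆ B) := by
  let p := (ReciprocalPair.ofEquiv e).comp (ReciprocalPair.inl E M A)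
  let q₁ := (ReciprocalPair.inl E M B).symm.comp p
  let q₂ := (ReciprocalPair.inr E M B).symm.comp p
  have hq₁ : ∀ m, q₁.hom m = (e (m, 0)).1 := fun _ => rfl
  have hq₁' : ∀ m, q₁.back m = (e.symm (m, 0)).1 := fun _ => rfl
  have hq₂ : ∀ m, q₂.hom m = (e (m, 0)).2 := fun _ => rfl
  have hq₂' : ∀ m, q₂.back m = (e.symm (0, m)).1 := fun _ => rfl
  let u₁ : Module.End E M := (q₁.back.comp q₁.hom : M →ₗ⁅E⁆ M)
  let u₂ : Module.End E M := (q₂.back.comp q₂.hom : M →ₗ⁅E⁆ M)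
  have hsum : u₁ + u₂ = 1 := by
    ext m
    change q₁.back (q₁.hom m) + q₂.back (q₂.hom m) = m
    rw [hq₁', hq₂', hq₁, hq₂, ← Prod.fst_add, ← map_add, Prod.mk_add_mk, add_zero, zero_add,
      Prod.mk.eta, e.symm_apply_apply]
  -- The identity of `M` is the sum of the round trips through the two factors of `M × B`, so one of
  -- them is bijective. If it is the one through `M`, both of its legs are bijective by dimension,
  -- and `A` and `B` are complements of the same factor.
  rcases hM.bijective_or_of_add u₁ u₂ q₁.back_hom_lie q₂.back_hom_lie
    (by rw [hsum]; exact Function.bijective_id) with h | h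
  · have hi : Function.Injective (q₁.hom : M →ₗ[E] M) := fun x y hxy =>
      h.1 (congrArg q₁.back hxy)
    have hb : Function.Bijective q₁.hom := ⟨hi, LinearMap.injective_iff_surjective.mp hi⟩
    exact nonempty_equiv_of_bijective_fst_symm e
      (Function.Bijective.of_comp_iff _ hb |>.mp h)
  -- Here `M` splits off from `B`. Exchanging this copy of `M` with the original one gives `A ≅ M ×
  -- ker ≅ B`.
  · obtain ⟨φ, hφ⟩ := q₂.exists_equiv_prod_ker h
    let e' : (M × A) ≃ₗ⁅E⁆ M × M × q₂.back.ker :=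
      e.trans ((LieEquiv.prodComm E M B).trans ((prodCongrLieEquiv φ.symm LieEquiv.refl).trans
        (prodAssocLieEquiv E M q₂.back.ker M) |>.trans
          (prodCongrLieEquiv LieEquiv.refl (LieEquiv.prodComm E _ _))))
    obtain ⟨ψ⟩ := nonempty_equiv_of_bijective_fst_symm e' (by
      convert h using 2 with m
      change (e.symm (0, φ (m, 0))).1 = q₂.back (q₂.hom m)
      rw [hφ, hq₂', LieSubmodule.coe_zero, add_zero])
    exact ⟨ψ.trans φ⟩

/-- Cancellation for Lie algebras in a common universe. -/
theorem nonempty_equiv_of_prod_of_universe {n : ℕ} : ∀ {M A B : Type u}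
    [LieRing M] [LieAlgebra E M] [FiniteDimensional E M] [LieRing A] [LieAlgebra E A]
    [LieRing B] [LieAlgebra E B], Module.finrank E M = n → ((M × A) ≃ₗ⁅E⁆ M × B) →
    Nonempty (A ≃ₗ⁅E⁆ B) := by
  induction n using Nat.strong_induction_on with | _ n ih => ?_
  intro M A B _ _ _ _ _ _ _ hn e
  by_cases hM : IsIndecomposable E M
  · exact hM.nonempty_equiv_of_prod e
  · obtain ⟨I, J, hI, hJ, hIJ⟩ := not_not.mp hM
    have hlt : ∀ K : LieIdeal E M, K ≠ ⊤ → Module.finrank E K < n := fun K hK => by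
      rw [← hn]
      refine Submodule.finrank_lt (s := K.toSubmodule) fun h => hK ?_
      exact (LieSubmodule.toSubmodule_eq_top K).mp h
    obtain ⟨φ⟩ := nonempty_prod_equiv_of_isCompl hIJ
    let s (C : Type u) [LieRing C] [LieAlgebra E C] : (M × C) ≃ₗ⁅E⁆ I × J × C :=
      (prodCongrLieEquiv φ.symm LieEquiv.refl).trans (prodAssocLieEquiv E I J C)
    obtain ⟨ψ⟩ := ih _ (hlt I hI) rfl ((s A).symm.trans (e.trans (s B)))
    exact ih _ (hlt J hJ) rfl ψ

/-- Finite-dimensional Lie algebras can be cancelled from products. -/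
theorem nonempty_equiv_of_prod {M A B : Type*}
    [LieRing M] [LieAlgebra E M] [FiniteDimensional E M] [LieRing A] [LieAlgebra E A]
    [LieRing B] [LieAlgebra E B] (e : (M × A) ≃ₗ⁅E⁆ M × B) : Nonempty (A ≃ₗ⁅E⁆ B) := by
  -- The induction on dimension needs a fixed universe; all three algebras have copies inside `M ×
  -- A`.
  let a : A ≃ₗ⁅E⁆ (LieHom.inr E M A).range := LieEquiv.ofInjective _ LieHom.inr_injective
  let m : M ≃ₗ⁅E⁆ (LieHom.inl E M A).range := LieEquiv.ofInjective _ LieHom.inl_injective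
  let b : B ≃ₗ⁅E⁆ ((e.symm : (M × B) →ₗ⁅E⁆ M × A).comp (LieHom.inr E M B)).range :=
    LieEquiv.ofInjective _ (e.symm.injective.comp LieHom.inr_injective)
  have : FiniteDimensional E (LieHom.inl E M A).range := m.toLinearEquiv.finiteDimensional
  obtain ⟨ψ⟩ := nonempty_equiv_of_prod_of_universe rfl
    (((prodCongrLieEquiv m a).symm.trans e).trans (prodCongrLieEquiv m b))
  exact ⟨a.trans (ψ.trans b.symm)⟩

end Cancellation

/-! ### The exchange property -/

section Exchange

variable {E : Type*} [Field E]

/-- Exchange property: an indecomposable direct factor of a finite product is a direct factor of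
one of the factors. -/
theorem IsIndecomposable.exists_equiv_prod {M L ι : Type*} [Fintype ι] [Nonempty ι]
    [LieRing M] [LieAlgebra E M] [FiniteDimensional E M] [LieRing L] [LieAlgebra E L]
    (N : ι → Type*) [∀ i, LieRing (N i)] [∀ i, LieAlgebra E (N i)]
    (hM : IsIndecomposable E M) (p : ReciprocalPair E M L) (hp : ∀ x, p.back (p.hom x) = x)
    (q : ∀ i, ReciprocalPair E (N i) L) (hq : ∀ y, ∑ i, (q i).hom ((q i).back y) = y) :
    ∃ (i : ι) (I : LieIdeal E (N i)), Nonempty ((M × I) ≃ₗ⁅E⁆ N i) := by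
  let r i := (q i).symm.comp p
  let u i : Module.End E M := ((r i).back.comp (r i).hom : M →ₗ⁅E⁆ M)
  have hsum : ∑ i, u i = 1 := by
    ext m
    rw [LinearMap.sum_apply]
    change ∑ i, p.back ((q i).hom ((q i).back (p.hom m))) = m
    rw [← map_sum, hq, hp]
  obtain ⟨i, -, h⟩ := hM.exists_bijective_of_sum Finset.univ_nonempty u
    (fun i => (r i).back_hom_lie) (by rw [hsum]; exact Function.bijective_id)
  obtain ⟨φ, -⟩ := (r i).exists_equiv_prod_ker h
  exact ⟨i, _, ⟨φ⟩⟩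

end Exchange

/-! ### Products of families -/

section Pi

variable {ι : Type*} (L : ι → Type*) [∀ i, LieRing (L i)]

instance piLieRing : LieRing (∀ i, L i) where
  bracket x y i := ⁅x i, y i⁆
  add_lie x y z := funext fun i => add_lie (x i) (y i) (z i)
  lie_add x y z := funext fun i => lie_add (x i) (y i) (z i)
  lie_self x := funext fun i => lie_self (x i)
  leibniz_lie x y z := funext fun i => leibniz_lie (x i) (y i) (z i)

@[simp]
theorem pi_lie_apply (x y : ∀ i, L i) (i : ι) : ⁅x, y⁆ i = ⁅x i, y i⁆ := rfl

variable (R : Type*) [CommRing R] [∀ i, LieAlgebra R (L i)]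

instance piLieAlgebra : LieAlgebra R (∀ i, L i) where
  lie_smul t x y := funext fun i => lie_smul t (x i) (y i)

variable {L R}

/-- The product of a family of isomorphisms of Lie algebras. -/
def piCongrLieEquiv {M : ι → Type*} [∀ i, LieRing (M i)] [∀ i, LieAlgebra R (M i)]
    (e : ∀ i, L i ≃ₗ⁅R⁆ M i) : (∀ i, L i) ≃ₗ⁅R⁆ ∀ i, M i where
  __ := LinearEquiv.piCongrRight fun i => (e i).toLinearEquiv
  map_lie' {x y} := funext fun i => (e i).map_lie (x i) (y i)

variable (R L)

/-- A product of binary products of Lie algebras. -/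
def piProdLieEquiv (M : ι → Type*) [∀ i, LieRing (M i)] [∀ i, LieAlgebra R (M i)] :
    (∀ i, L i × M i) ≃ₗ⁅R⁆ (∀ i, L i) × ∀ i, M i where
  toFun z := (fun i => (z i).1, fun i => (z i).2)
  invFun z i := (z.1 i, z.2 i)
  map_add' _ _ := rfl
  map_smul' _ _ := rfl
  map_lie' := rfl
  left_inv _ := rfl
  right_inv _ := rfl

/-- Reindexing a product of Lie algebras. -/
noncomputable def piReindexLieEquiv {κ : Type*} (e : κ ≃ ι) :
    (∀ i, L i) ≃ₗ⁅R⁆ ∀ j, L (e j) :=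
  LieEquiv.ofBijective
    { toFun := fun x j => x (e j)
      map_add' := fun _ _ => rfl
      map_smul' := fun _ _ => rfl
      map_lie' := rfl }
    ⟨fun x y hxy => funext fun i => by
      obtain ⟨j, rfl⟩ := e.surjective i
      exact congrFun hxy j,
    fun y => ⟨(Equiv.piCongrLeft L e) y, funext fun j => Equiv.piCongrLeft_apply_apply L e y j⟩⟩

/-- The finite direct sum of Lie algebras as a product. -/
noncomputable def directSumLieEquivPi [Fintype ι] : (⨁ i, L i) ≃ₗ⁅R⁆ ∀ i, L i where
  __ := DirectSum.linearEquivFunOnFintype R ι L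
  map_lie' {x y} := funext fun i => DirectSum.bracket_apply L x y i

/-- Splitting off the first factor of a product of Lie algebras. -/
noncomputable def piFinSuccLieEquiv {k : ℕ} (L : Fin (k + 1) → Type*) [∀ i, LieRing (L i)]
    [∀ i, LieAlgebra R (L i)] : (∀ i, L i) ≃ₗ⁅R⁆ L 0 × ∀ i : Fin k, L i.succ :=
  LieEquiv.ofBijective
    { toFun := fun x => (x 0, fun i => x i.succ)
      map_add' := fun _ _ => rfl
      map_smul' := fun _ _ => rfl
      map_lie' := rfl }
    ⟨fun _ _ hxy => funext <| Fin.cases (congrArg Prod.fst hxy)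
      fun i => congrFun (congrArg Prod.snd hxy) i,
    fun y => ⟨Fin.cons y.1 y.2, rfl⟩⟩

/-- The inclusion of, and the projection onto, a factor of a product of Lie algebras. -/
def ReciprocalPair.single [DecidableEq ι] (i : ι) : ReciprocalPair R (L i) (∀ i, L i) where
  hom :=
    { LinearMap.single R L i with
      map_lie' := fun {x y} => funext fun j => by
        obtain rfl | h := eq_or_ne j i
        · simp
        · simp [Pi.single_eq_of_ne h] }
  back :=
    { LinearMap.proj i with
      map_lie' := rfl }
  hom_lie x y := funext fun j => by
    change Pi.single i ⁅x, y i⁆ j = ⁅(Pi.single i x : ∀ i, L i) j, y j⁆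
    obtain rfl | h := eq_or_ne j i
    · simp
    · simp [Pi.single_eq_of_ne h]
  back_lie x y := by
    change ⁅(Pi.single i x : ∀ i, L i) i, y i⁆ = ⁅x, y i⁆
    rw [Pi.single_eq_same]

variable {R}

/-- A Lie algebra which is the internal direct sum of ideals is their product. -/
theorem nonempty_equiv_pi_of_isInternal [Fintype ι] [DecidableEq ι] {g : Type*} [LieRing g]
    [LieAlgebra R g] (I : ι → LieIdeal R g) (h : DirectSum.IsInternal I) :
    Nonempty (g ≃ₗ⁅R⁆ ∀ i, I i) := by
  let f := DirectSum.toLieAlgebra g (fun i => (I i).incl) (by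
    intro i j hij x y
    have hind := (DirectSum.isInternal_submodule_iff_iSupIndep_and_iSup_eq_top
      (fun i => (I i).toSubmodule)).mp h
    have hd := hind.1.pairwiseDisjoint hij
    have h1 : ⁅(x : g), (y : g)⁆ ∈ (I i).toSubmodule ⊓ (I j).toSubmodule :=
      ⟨lie_mem_left R g (I i) x y x.2, (I j).lie_mem y.2⟩
    rwa [hd.eq_bot, Submodule.mem_bot] at h1)
  have hf : Function.Bijective f := h
  exact ⟨(LieEquiv.ofBijective f hf).symm.trans (directSumLieEquivPi (fun i => I i) R)⟩

end Pi

/-! ### Functoriality of conjugation -/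

section Conjugate

variable {E : Type*} [Field E]

namespace SigmaIso

variable {X Y Z : Type*} [LieRing X] [LieAlgebra E X] [LieRing Y] [LieAlgebra E Y]
  [LieRing Z] [LieAlgebra E Z]

/-- An isomorphism of Lie algebras as a semilinear isomorphism. -/
def ofLieEquiv (e : X ≃ₗ⁅E⁆ Y) : SigmaIso (RingEquiv.refl E) X Y where
  toFun := e
  bijective := e.bijective
  map_add := fun x y => e.toLinearEquiv.map_add x y
  map_smul := fun c x => e.toLinearEquiv.map_smul c x
  map_lie := e.map_lie

/-- Composition of semilinear isomorphisms. -/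
def trans {σ τ υ : E ≃+* E} (φ : SigmaIso σ X Y) (ψ : SigmaIso τ Y Z)
    (h : ∀ c, τ (σ c) = υ c) : SigmaIso υ X Z where
  toFun x := ψ.toFun (φ.toFun x)
  bijective := ψ.bijective.comp φ.bijective
  map_add x y := by rw [φ.map_add, ψ.map_add]
  map_smul c x := by rw [φ.map_smul, ψ.map_smul, h]
  map_lie x y := by rw [φ.map_lie, ψ.map_lie]

end SigmaIso

namespace Conjugate

variable {X Y : Type*} [LieRing X] [LieAlgebra E X] [LieRing Y] [LieAlgebra E Y]

theorem nonempty_congr (σ : E ≃+* E) (e : X ≃ₗ⁅E⁆ Y) :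
    Nonempty (Conjugate σ X ≃ₗ⁅E⁆ Conjugate σ Y) :=
  nonempty_lieEquiv σ X ((SigmaIso.ofLieEquiv e).trans (sigmaIso σ Y) fun _ => rfl)

theorem nonempty_conjugate (σ τ υ : E ≃+* E) (h : ∀ c, τ (σ c) = υ c) :
    Nonempty (Conjugate υ X ≃ₗ⁅E⁆ Conjugate τ (Conjugate σ X)) :=
  nonempty_lieEquiv υ X ((sigmaIso σ X).trans (sigmaIso τ _) h)

theorem nonempty_of_forall_eq (σ : E ≃+* E) (h : ∀ c, σ c = c) :
    Nonempty (Conjugate σ X ≃ₗ⁅E⁆ X) :=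
  nonempty_lieEquiv σ X ((SigmaIso.ofLieEquiv LieEquiv.refl).trans
    (SigmaIso.ofLieEquiv LieEquiv.refl) fun c => (h c).symm)

/-- Conjugation commutes with products. -/
def prodEquiv (σ : E ≃+* E) (X Y : Type*) [LieRing X] [LieAlgebra E X] [LieRing Y]
    [LieAlgebra E Y] : Conjugate σ (X × Y) ≃ₗ⁅E⁆ Conjugate σ X × Conjugate σ Y where
  toFun z := (of σ X ((of σ (X × Y)).symm z).1, of σ Y ((of σ (X × Y)).symm z).2)
  invFun z := of σ (X × Y) ((of σ X).symm z.1, (of σ Y).symm z.2)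
  map_add' _ _ := rfl
  map_smul' _ _ := rfl
  map_lie' := rfl
  left_inv _ := rfl
  right_inv _ := rfl

instance (σ : E ≃+* E) [FiniteDimensional E X] : FiniteDimensional E (Conjugate σ X) := by
  have : RingHomSurjective (σ : E →+* E) := ⟨σ.surjective⟩
  let f : X →ₛₗ[(σ : E →+* E)] Conjugate σ X :=
    { toFun := of σ X
      map_add' := map_add _
      map_smul' := (sigmaIso σ X).map_smul }
  exact Module.Finite.of_surjective f (of σ X).surjective

end Conjugate

end Conjugate

/-! ### The product of all Galois conjugates -/

section ConjugateProd

variable (F E : Type*) [Field F] [Field E] [Algebra F E]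

/-- The product of all Galois conjugates of a Lie algebra. -/
abbrev ConjugateProd (X : Type*) : Type _ :=
  ∀ σ : E ≃ₐ[F] E, Conjugate σ.toRingEquiv X

variable {X Y : Type*} [LieRing X] [LieAlgebra E X] [LieRing Y] [LieAlgebra E Y]

namespace ConjugateProd

theorem nonempty_congr (e : X ≃ₗ⁅E⁆ Y) :
    Nonempty (ConjugateProd F E X ≃ₗ⁅E⁆ ConjugateProd F E Y) :=
  ⟨piCongrLieEquiv fun σ => (Conjugate.nonempty_congr σ.toRingEquiv e).some⟩

variable (X) in
-- Right translation by `τ` permutes the Galois group, so conjugating first only reindexes the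
-- factors.
theorem nonempty_conjugate (τ : E ≃ₐ[F] E) :
    Nonempty (ConjugateProd F E X ≃ₗ⁅E⁆ ConjugateProd F E (Conjugate τ.toRingEquiv X)) :=
  ⟨(piReindexLieEquiv (fun σ : E ≃ₐ[F] E => Conjugate σ.toRingEquiv X) E
    (Equiv.mulRight τ)).trans (piCongrLieEquiv fun σ =>
      (Conjugate.nonempty_conjugate τ.toRingEquiv σ.toRingEquiv
        (σ * τ).toRingEquiv fun _ => rfl).some)⟩

variable (X Y) in
theorem nonempty_prod :
    Nonempty (ConjugateProd F E (X × Y) ≃ₗ⁅E⁆ ConjugateProd F E X × ConjugateProd F E Y) := by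
  let a : ConjugateProd F E (X × Y) ≃ₗ⁅E⁆
      ∀ σ : E ≃ₐ[F] E, Conjugate σ.toRingEquiv X × Conjugate σ.toRingEquiv Y :=
    piCongrLieEquiv fun σ => Conjugate.prodEquiv σ.toRingEquiv X Y
  let b := piProdLieEquiv (fun σ : E ≃ₐ[F] E => Conjugate σ.toRingEquiv X) E
    fun σ : E ≃ₐ[F] E => Conjugate σ.toRingEquiv Y
  exact ⟨a.trans b⟩

end ConjugateProd

end ConjugateProd

/-! ### Krull–Schmidt descent from the products to the algebras -/

section Descent

variable {F E : Type*} [Field F] [Field E] [Algebra F E] [FiniteDimensional F E]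

/-- If the products of all conjugates of `M × X` and `H` are isomorphic with `M` indecomposable,
then a conjugate of `M` is a direct factor of `H`, and the complement of it is compatible
with that of `M`. -/
theorem ConjugateProd.exists_factor {M X H : Type*}
    [LieRing M] [LieAlgebra E M] [FiniteDimensional E M] [LieRing X] [LieAlgebra E X]
    [LieRing H] [LieAlgebra E H] (hM : IsIndecomposable E M)
    (e : ConjugateProd F E (M × X) ≃ₗ⁅E⁆ ConjugateProd F E H) :
    ∃ (τ ρ : E ≃ₐ[F] E) (I : LieIdeal E (Conjugate ρ.toRingEquiv H)),
      Nonempty (H ≃ₗ⁅E⁆ Conjugate τ.toRingEquiv M × Conjugate τ.toRingEquiv I) ∧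
      Nonempty (ConjugateProd F E X ≃ₗ⁅E⁆ ConjugateProd F E (Conjugate τ.toRingEquiv I)) := by
  classical
  obtain ⟨s⟩ := nonempty_prod F E M X
  obtain ⟨c⟩ := Conjugate.nonempty_of_forall_eq (X := M) (1 : E ≃ₐ[F] E).toRingEquiv fun _ => rfl
  let p : ReciprocalPair E M (ConjugateProd F E H) :=
    (ReciprocalPair.ofEquiv (s.symm.trans e)).comp ((ReciprocalPair.inl E _ _).comp
      ((ReciprocalPair.single (fun σ : E ≃ₐ[F] E => Conjugate σ.toRingEquiv M) E 1).comp
        (ReciprocalPair.ofEquiv c.symm)))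
  have hp : ∀ x, p.back (p.hom x) = x := fun x => by
    change c ((s (e.symm (e (s.symm (Pi.single 1 (c.symm x), 0))))).1 1) = x
    rw [e.symm_apply_apply, s.apply_symm_apply]
    change c ((Pi.single 1 (c.symm x) : ConjugateProd F E M) 1) = x
    rw [Pi.single_eq_same, c.apply_symm_apply]
  obtain ⟨ρ, I, ⟨ψ⟩⟩ := hM.exists_equiv_prod _ p hp
    (ReciprocalPair.single (fun σ : E ≃ₐ[F] E => Conjugate σ.toRingEquiv H) E)
    (fun y => Finset.univ_sum_single y)
  -- Conjugating `H^ρ ≅ M × I` by `ρ⁻¹` recovers `H` itself.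
  let τ := ρ⁻¹
  obtain ⟨c₁⟩ := Conjugate.nonempty_of_forall_eq (X := H) (1 : E ≃ₐ[F] E).toRingEquiv fun _ => rfl
  obtain ⟨c₂⟩ := Conjugate.nonempty_conjugate (X := H) ρ.toRingEquiv τ.toRingEquiv
    (1 : E ≃ₐ[F] E).toRingEquiv ρ.symm_apply_apply
  obtain ⟨c₃⟩ := Conjugate.nonempty_congr τ.toRingEquiv ψ.symm
  let d : H ≃ₗ⁅E⁆ Conjugate τ.toRingEquiv M × Conjugate τ.toRingEquiv I :=
    c₁.symm.trans (c₂.trans (c₃.trans (Conjugate.prodEquiv _ _ _)))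
  refine ⟨τ, ρ, I, ⟨d⟩, ?_⟩
  obtain ⟨d'⟩ := nonempty_congr F E d
  obtain ⟨s'⟩ := nonempty_prod F E (Conjugate τ.toRingEquiv M) (Conjugate τ.toRingEquiv I)
  obtain ⟨t⟩ := nonempty_conjugate F E M τ
  -- The cancelled factor is the product of all conjugates of `M`, finite-dimensional because the
  -- Galois group is finite.
  exact nonempty_equiv_of_prod (s.symm.trans (e.trans (d'.trans (s'.trans
    (prodCongrLieEquiv t.symm LieEquiv.refl)))))

/-- If the products of all conjugates of `∏ i, G i` and of `H` are isomorphic, with each `G i`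
indecomposable, then `H` is a product of conjugates of the `G i`. -/
theorem ConjugateProd.exists_equiv_pi_conjugate {k : ℕ} (G : Fin k → Type*)
    [∀ i, LieRing (G i)] [∀ i, LieAlgebra E (G i)] [∀ i, FiniteDimensional E (G i)]
    (hG : ∀ i, IsIndecomposable E (G i)) {H : Type*} [LieRing H] [LieAlgebra E H]
    (e : ConjugateProd F E (∀ i, G i) ≃ₗ⁅E⁆ ConjugateProd F E H) :
    ∃ σ : Fin k → (E ≃ₐ[F] E),
      Nonempty (H ≃ₗ⁅E⁆ ∀ i, Conjugate (σ i).toRingEquiv (G i)) := by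
  induction k generalizing H with
  | zero =>
    have h0 : ∀ y : H, y = 0 := fun y => by
      have h1 : e.symm (fun σ => Conjugate.of σ.toRingEquiv H y) = e.symm 0 :=
        funext fun σ => funext fun i => i.elim0
      exact congrFun (e.symm.injective h1) 1
    let f : H →ₗ⁅E⁆ ∀ i : Fin 0, Conjugate (1 : E ≃ₐ[F] E).toRingEquiv (G i) := 0
    exact ⟨fun _ => 1, ⟨LieEquiv.ofBijective f
      ⟨fun x y _ => (h0 x).trans (h0 y).symm, fun z => ⟨0, funext fun i => i.elim0⟩⟩⟩⟩
  | succ k ih =>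
    obtain ⟨t⟩ := nonempty_congr F E (piFinSuccLieEquiv E G)
    obtain ⟨τ, ρ, I, ⟨d⟩, ⟨e'⟩⟩ := exists_factor (hG 0) (t.symm.trans e)
    obtain ⟨σ, ⟨ψ⟩⟩ := ih (fun i => G i.succ) (fun i => hG i.succ) e'
    refine ⟨Fin.cons τ σ, ⟨d.trans ((prodCongrLieEquiv LieEquiv.refl ψ).trans
      (piFinSuccLieEquiv E fun i =>
        Conjugate ((Fin.cons τ σ : Fin (k + 1) → (E ≃ₐ[F] E)) i).toRingEquiv (G i)).symm)⟩⟩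

end Descent

/-! ### Extension of scalars as the product of conjugates -/

section BaseChange

open TensorProduct

/-- An identification of a Lie algebra `L` over `F` with the Lie algebra underlying a Lie
algebra `X` over an extension `E`. -/
structure ScalarRestriction (F E : Type*) [Field F] [Field E] [Algebra F E]
    (L : Type*) [LieRing L] [LieAlgebra F L] (X : Type*) [LieRing X] [LieAlgebra E X]
    extends L ≃+ X where
  map_smul' : ∀ (r : F) (x : L), toFun (r • x) = algebraMap F E r • toFun x
  map_lie' : ∀ x y : L, toFun ⁅x, y⁆ = ⁅toFun x, toFun y⁆

variable {F E : Type*} [Field F] [Field E] [Algebra F E]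
  {L : Type*} [LieRing L] [LieAlgebra F L] {X : Type*} [LieRing X] [LieAlgebra E X]
  (φ : ScalarRestriction F E L X)

namespace ScalarRestriction

theorem map_smul (r : F) (x : L) :
    φ.toAddEquiv (r • x) = algebraMap F E r • φ.toAddEquiv x := φ.map_smul' r x

theorem map_lie (x y : L) :
    φ.toAddEquiv ⁅x, y⁆ = ⁅φ.toAddEquiv x, φ.toAddEquiv y⁆ := φ.map_lie' x y

/-- The canonical additive map from `E ⊗[F] L` to the product of the conjugates of `X`. -/
noncomputable def tensorAddHom : E ⊗[F] L →+ ConjugateProd F E X :=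
  TensorProduct.liftAddHom
    { toFun := fun a =>
        { toFun := fun x σ => Conjugate.of σ.toRingEquiv X (σ.symm a • φ.toAddEquiv x)
          map_zero' := funext fun σ => by simp
          map_add' := fun x y => funext fun σ => by simp }
      map_zero' := AddMonoidHom.ext fun x => funext fun σ => by simp
      map_add' := fun a b => AddMonoidHom.ext fun x => funext fun σ => by
        simp [add_smul] }
    fun r a x => funext fun σ => by
      simp [φ.map_smul, smul_smul, mul_comm, Algebra.smul_def]

theorem tensorAddHom_tmul (a : E) (x : L) (σ : E ≃ₐ[F] E) :
    φ.tensorAddHom (a ⊗ₜ x) σ =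
      Conjugate.of σ.toRingEquiv X (σ.symm a • φ.toAddEquiv x) := rfl

/-- The canonical morphism from the extension of scalars of the underlying Lie algebra of `X` to
the product of the conjugates of `X`. -/
noncomputable def tensorHom : E ⊗[F] L →ₗ⁅E⁆ ConjugateProd F E X where
  toFun := φ.tensorAddHom
  map_add' := map_add _
  map_smul' c z := by
    induction z with
    | zero => simp
    | add y z hy hz => simp only [smul_add, map_add, hy, hz]
    | tmul a x =>
      funext σ
      rw [smul_tmul', tensorAddHom_tmul, Pi.smul_apply, tensorAddHom_tmul,
        RingHom.id_apply, Conjugate.smul_def]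
      simp only [smul_eq_mul, map_mul, mul_smul, AddEquiv.symm_apply_apply]
      rfl
  map_lie' {y z} := by
    change φ.tensorAddHom ⁅y, z⁆ = ⁅φ.tensorAddHom y, φ.tensorAddHom z⁆
    induction y with
    | zero => simp
    | add y y' hy hy' => simp only [add_lie, map_add, hy, hy']
    | tmul a x =>
      induction z with
      | zero => simp
      | add y z hy hz => simp only [lie_add, map_add, hy, hz]
      | tmul b w =>
        funext σ
        rw [LieAlgebra.ExtendScalars.bracket_tmul, tensorAddHom_tmul, pi_lie_apply,
          tensorAddHom_tmul, tensorAddHom_tmul, Conjugate.lie_def, φ.map_lie]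
        simp only [AddEquiv.symm_apply_apply, smul_lie, lie_smul, map_mul, mul_smul]
        rw [smul_comm]

theorem tensorHom_tmul (a : E) (x : L) (σ : E ≃ₐ[F] E) :
    φ.tensorHom (a ⊗ₜ x) σ =
      Conjugate.of σ.toRingEquiv X (σ.symm a • φ.toAddEquiv x) := rfl

variable [FiniteDimensional F E] [IsGalois F E]

/-- The inverse is given by a basis of `E` over `F` and its dual basis for the trace form. -/
theorem tensorHom_bijective : Function.Bijective φ.tensorHom := by
  classical
  let e := Module.finBasis F E
  let b := e.traceDual
  have hsum : ∀ a : E, ∑ i, Algebra.trace F E (b i * a) • e i = a := fun a => by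
    conv_rhs => rw [← e.sum_repr a]
    refine Finset.sum_congr rfl fun i _ => ?_
    congr 1
    conv_lhs => rw [← e.sum_repr a]
    simp only [Finset.mul_sum, mul_smul_comm, map_sum, LinearMap.map_smul, b,
      Module.Basis.trace_traceDual_mul, smul_eq_mul, mul_ite, mul_one, mul_zero,
      Finset.sum_ite_eq', Finset.mem_univ, if_true]
  have htr : ∀ a : E, ∑ σ : E ≃ₐ[F] E, σ.symm a = algebraMap F E (Algebra.trace F E a) :=
    fun a => by
      rw [trace_eq_sum_automorphisms]
      exact Fintype.sum_equiv (Equiv.inv _) _ _ fun _ => rfl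
  -- Trace duality, with the trace written as a sum of conjugates, says `A * B = 1`. As there are
  -- `[E : F]` automorphisms, the one-sided inverse is two-sided, and `B * A = 1` is this
  -- orthogonality relation.
  have hdual : ∀ σ τ : E ≃ₐ[F] E, ∑ i, τ.symm (e i) * σ.symm (b i) = if τ = σ then 1 else 0 := by
    let A : Matrix (Fin (Module.finrank F E)) (E ≃ₐ[F] E) E := fun i σ => σ.symm (b i)
    let B : Matrix (E ≃ₐ[F] E) (Fin (Module.finrank F E)) E := fun σ i => σ.symm (e i)
    have hAB : A * B = 1 := by
      ext i j
      rw [Matrix.mul_apply, Matrix.one_apply]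
      simp only [A, B, ← map_mul]
      rw [htr, Module.Basis.trace_traceDual_mul]
      simp [eq_comm]
    have hBA : B * A = 1 := (Matrix.mul_eq_one_comm_of_card_eq _ _ _ (by
      rw [Fintype.card_fin, ← Nat.card_eq_fintype_card]
      exact (IsGalois.card_aut_eq_finrank F E).symm)).mp hAB
    intro σ τ
    have := congrFun (congrFun hBA τ) σ
    rwa [Matrix.mul_apply, Matrix.one_apply] at this
  let inv : ConjugateProd F E X →+ E ⊗[F] L :=
    { toFun := fun y => ∑ i, e i ⊗ₜ[F] φ.toAddEquiv.symm
        (∑ σ : E ≃ₐ[F] E, σ.symm (b i) • (Conjugate.of σ.toRingEquiv X).symm (y σ))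
      map_zero' := by simp
      map_add' := fun y z => by
        simp only [Pi.add_apply, map_add, smul_add, Finset.sum_add_distrib, tmul_add] }
  have hinv : ∀ y, inv y = ∑ i, e i ⊗ₜ[F] φ.toAddEquiv.symm
        (∑ σ : E ≃ₐ[F] E, σ.symm (b i) • (Conjugate.of σ.toRingEquiv X).symm (y σ)) :=
    fun _ => rfl
  have hleft : ∀ z, inv (φ.tensorHom z) = z := fun z => by
    induction z with
    | zero => simp
    | add y z hy hz => rw [map_add, map_add, hy, hz]
    | tmul a x =>
      rw [hinv]
      conv_rhs => rw [← hsum a, sum_tmul]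
      refine Finset.sum_congr rfl fun i _ => ?_
      rw [smul_tmul]
      congr 1
      simp only [tensorHom_tmul, AddEquiv.symm_apply_apply, smul_smul, ← map_mul]
      rw [← Finset.sum_smul, htr, AddEquiv.symm_apply_eq, φ.map_smul]
      
  -- After interchanging the sums, the orthogonality `hdual` isolates the `τ`-component of `y`.
  have hright : ∀ y, φ.tensorHom (inv y) = y := fun y => by
    funext τ
    rw [hinv, map_sum, Finset.sum_apply]
    simp only [tensorHom_tmul, AddEquiv.apply_symm_apply, Finset.smul_sum, smul_smul]
    rw [← map_sum, Finset.sum_comm]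
    simp only [← Finset.sum_smul, hdual, ite_smul, one_smul, zero_smul]
    simp
  exact ⟨Function.LeftInverse.injective hleft, Function.RightInverse.surjective hright⟩

/-- Lie algebras with isomorphic restrictions of scalars have isomorphic products of conjugates. -/
theorem nonempty_equiv_conjugateProd {L L' X Y : Type*} [LieRing L] [LieAlgebra F L]
    [LieRing X] [LieAlgebra E X] [LieRing L'] [LieAlgebra F L'] [LieRing Y]
    [LieAlgebra E Y] (φ : ScalarRestriction F E L X)
    (ψ : ScalarRestriction F E L' Y) (e : L ≃ₗ⁅F⁆ L') :
    Nonempty (ConjugateProd F E X ≃ₗ⁅E⁆ ConjugateProd F E Y) := by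
  let t : E ⊗[F] L ≃ₗ⁅E⁆ E ⊗[F] L' :=
    { e.toLinearEquiv.baseChange F E _ _ with
      map_lie' := fun {x y} =>
        (LieAlgebra.ExtendScalars.map (AlgHom.id F E) (e : L →ₗ⁅F⁆ L')).map_lie x y }
  exact ⟨(LieEquiv.ofBijective _ φ.tensorHom_bijective).symm.trans
    (t.trans (LieEquiv.ofBijective _ ψ.tensorHom_bijective))⟩

variable (F E X) in
/-- The identity map of a Lie algebra with restricted scalars. -/
def restrictScalars : ScalarRestriction F E (RestrictScalars F E X) X where
  __ := RestrictScalars.addEquiv F E X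
  map_smul' _ _ := rfl
  map_lie' _ _ := rfl

end ScalarRestriction

end BaseChange

end UnderlyingLie

theorem mainTheorem2 {F E : Type*} [Field F] [Field E] [Algebra F E]
    [FiniteDimensional F E] [IsGalois F E]
    {g h : Type*} [LieRing g] [LieAlgebra E g] [FiniteDimensional E g]
    [LieRing h] [LieAlgebra E h]
    (hgh : Nonempty (RestrictScalars F E g ≃ₗ⁅F⁆ RestrictScalars F E h))
    {k : ℕ} (I : Fin k → LieIdeal E g)
    (hI : UnderlyingLie.IsIndecomposableDecomposition E I) :
    ∃ σ : Fin k → (E ≃ₐ[F] E),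
      Nonempty (h ≃ₗ⁅E⁆ ⨁ i, UnderlyingLie.Conjugate (σ i).toRingEquiv (I i)) := by
  obtain ⟨φ⟩ := hgh
  obtain ⟨d⟩ := UnderlyingLie.nonempty_equiv_pi_of_isInternal I hI.isInternal
  obtain ⟨d'⟩ := UnderlyingLie.ConjugateProd.nonempty_congr F E d.symm
  obtain ⟨e⟩ := (UnderlyingLie.ScalarRestriction.restrictScalars F E g).nonempty_equiv_conjugateProd
    (UnderlyingLie.ScalarRestriction.restrictScalars F E h) φ
  obtain ⟨σ, ⟨ψ⟩⟩ := UnderlyingLie.ConjugateProd.exists_equiv_pi_conjugate (fun i => I i)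
    hI.indecomposable (d'.trans e)
  exact ⟨σ, ⟨ψ.trans (UnderlyingLie.directSumLieEquivPi _ E).symm⟩⟩
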